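/- Let $M$ be a smooth Kähler manifold of real dimension $4$, with Riemannian metric $\langle\,,\rangle$ and complex-structure tensor $J$ (so $J$ is orthogonal, $J^2=-1$ and $\nabla J=0$). Let $(x_1,x_2,x_3,x_4)$ be smooth orthogonal local coordinates on an open set $U\subset M$, i.e. $\langle\partial/\partial x_i,\partial/\partial x_j\rangle=0$ on $U$ for $i\ne j$; put $a_i=\sqrt{\langle\partial/\partial x_i,\partial/\partial x_i\rangle}$ and let $e_i=\frac1{a_i}\frac{\partial}{\partial x_i}$ be the associated orthonormal frame. Let $R_{XY}Z=\nabla_{[X,Y]}Z-\nabla_X(\nabla_YZ)+\nabla_Y(\nabla_XZ)$, $R_{ijkl}=\langle R_{e_ie_j}e_k,e_l\rangle$, let $r=\sum_{i,j}R_{ijij}$ be the scalar curvature, and let $a_{ij}=\langle Je_i,e_j\rangle$. Then at every point of $U$, $$r=\frac{2}{a_{12}^2}(R_{1212}+R_{3434})=\frac{2}{a_{13}^2}(R_{1313}+R_{2424})=\frac{2}{a_{14}^2}(R_{1414}+R_{2323}),$$ where each expression is asserted wherever its denominator is nonzero; where $a_{1j}=0$, the corresponding sum $R_{1j1j}+R_{klkl}$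 (with $\{1,j,k,l\}=\{1,2,3,4\}$) vanishes. Consequently $R_{1212}+R_{3434}$, $R_{1313}+R_{2424}$ and $R_{1414}+R_{2323}$ all have the same sign: each of these sums with $a_{1j}\neq0$ has the same sign as $r$ (positive, zero or negative), the others vanish, and so either all three are $\ge0$ or all three are $\le0$. -/

import Mathlib

open scoped Manifold ContDiff Bundle

noncomputable section

namespace OrthCoord

/-! ### Local Riemannian geometry in coordinates

A metric on an open subset of `ℝⁿ` is given by its Gram matrix `g x = (⟨∂ᵢ, ∂ⱼ⟩)ᵢⱼ`.  Vector fields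
are maps `ℝⁿ → ℝⁿ`; the coordinate field `∂ᵢ` is the constant field `EuclideanSpace.single i 1`. -/

section Local

variable {n : ℕ}

/-- The `i`-th coordinate vector `∂ᵢ` of `ℝⁿ`. -/
def basisVec (i : Fin n) : EuclideanSpace ℝ (Fin n) := EuclideanSpace.single i 1

/-- The partial derivative `∂f/∂xᵢ` at `x`. -/
def partialDeriv (i : Fin n) (f : EuclideanSpace ℝ (Fin n) → ℝ)
    (x : EuclideanSpace ℝ (Fin n)) : ℝ :=
  fderiv ℝ f x (basisVec i)

/-- The inner product `⟨u, v⟩ = ∑ gᵢⱼ(x) uᵢ vⱼ` at the point `x`. -/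
def metricInner (g : EuclideanSpace ℝ (Fin n) → Matrix (Fin n) (Fin n) ℝ)
    (x u v : EuclideanSpace ℝ (Fin n)) : ℝ :=
  ∑ i, ∑ j, g x i j * u i * v j

/-- The Christoffel symbol
`Γᵏᵢⱼ = ½ ∑ₗ gᵏˡ (∂ᵢ gⱼₗ + ∂ⱼ gᵢₗ - ∂ₗ gᵢⱼ)` of the Levi-Civita connection. -/
def christoffel (g : EuclideanSpace ℝ (Fin n) → Matrix (Fin n) (Fin n) ℝ)
    (k i j : Fin n) (x : EuclideanSpace ℝ (Fin n)) : ℝ :=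
  (1 / 2 : ℝ) * ∑ l, (g x)⁻¹ k l *
    (partialDeriv i (fun y => g y j l) x + partialDeriv j (fun y => g y i l) x
      - partialDeriv l (fun y => g y i j) x)

/-- The Levi-Civita covariant derivative `∇_X Y` of vector fields:
`(∇_X Y)ᵏ = X(Yᵏ) + ∑ᵢⱼ Γᵏᵢⱼ Xⁱ Yʲ`. -/
def covDeriv (g : EuclideanSpace ℝ (Fin n) → Matrix (Fin n) (Fin n) ℝ)
    (X Y : EuclideanSpace ℝ (Fin n) → EuclideanSpace ℝ (Fin n))
    (x : EuclideanSpace ℝ (Fin n)) : EuclideanSpace ℝ (Fin n) :=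
  fderiv ℝ Y x (X x) +
    WithLp.toLp 2 (fun k => ∑ i, ∑ j, christoffel g k i j x * X x i * Y x j)

/-- The curvature operator, with the sign convention
`R_{XY} Z = ∇_{[X,Y]} Z - ∇_X (∇_Y Z) + ∇_Y (∇_X Z)`. -/
def curvOp (g : EuclideanSpace ℝ (Fin n) → Matrix (Fin n) (Fin n) ℝ)
    (X Y Z : EuclideanSpace ℝ (Fin n) → EuclideanSpace ℝ (Fin n))
    (x : EuclideanSpace ℝ (Fin n)) : EuclideanSpace ℝ (Fin n) :=
  covDeriv g (VectorField.lieBracket ℝ X Y) Z x - covDeriv g X (covDeriv g Y Z) x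
    + covDeriv g Y (covDeriv g X Z) x

/-- The curvature tensor `⟨R_{uv} w, z⟩` at `x`.  The value of `R_{XY} Z` at `x` depends only on the
values of `X, Y, Z` at `x`; the vectors `u, v, w` are extended with constant coefficients. -/
def riemann (g : EuclideanSpace ℝ (Fin n) → Matrix (Fin n) (Fin n) ℝ)
    (x u v w z : EuclideanSpace ℝ (Fin n)) : ℝ :=
  metricInner g x (curvOp g (fun _ => u) (fun _ => v) (fun _ => w) x) z

/-- The scalar curvature `∑ gⁱᵏ gʲˡ ⟨R_{∂ᵢ∂ⱼ} ∂ₖ, ∂ₗ⟩` at `x`, which is the sum of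
`⟨R_{eᵢeⱼ} eᵢ, eⱼ⟩` over an orthonormal basis. -/
def scalarCurv (g : EuclideanSpace ℝ (Fin n) → Matrix (Fin n) (Fin n) ℝ)
    (x : EuclideanSpace ℝ (Fin n)) : ℝ :=
  ∑ i, ∑ j, ∑ k, ∑ l, (g x)⁻¹ i k * (g x)⁻¹ j l *
    riemann g x (basisVec i) (basisVec j) (basisVec k) (basisVec l)

end Local

/-! ### Riemannian manifolds in a chart

Points of the domain of a chart `φ` are named by their coordinates `x ∈ φ.target`. -/

section Manifold

variable {n : ℕ} {M : Type*} [TopologicalSpace M] [ChartedSpace (EuclideanSpace ℝ (Fin n)) M]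

/-- The coordinate vector `∂/∂xᵢ ∈ T_p M` of the chart `φ` at the point `p = φ⁻¹(x)`. -/
def coordVec (φ : OpenPartialHomeomorph M (EuclideanSpace ℝ (Fin n))) (i : Fin n)
    (x : EuclideanSpace ℝ (Fin n)) : TangentSpace (𝓡 n) (φ.symm x) :=
  mfderiv (𝓡 n) (𝓡 n) φ.symm x (basisVec i)

/-- An endomorphism field `J` of the tangent bundle, read in the chart `φ`. -/
def chartEndo (J : ∀ p : M, TangentSpace (𝓡 n) p →L[ℝ] TangentSpace (𝓡 n) p)
    (φ : OpenPartialHomeomorph M (EuclideanSpace ℝ (Fin n)))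
    (x v : EuclideanSpace ℝ (Fin n)) : EuclideanSpace ℝ (Fin n) :=
  mfderiv (𝓡 n) (𝓡 n) φ (φ.symm x) (J (φ.symm x) (mfderiv (𝓡 n) (𝓡 n) φ.symm x v))

variable [IsManifold (𝓡 n) ∞ M] [Bundle.RiemannianBundle (fun p : M => TangentSpace (𝓡 n) p)]

/-- The Gram matrix `(⟨∂/∂xᵢ, ∂/∂xⱼ⟩)ᵢⱼ` of the Riemannian metric in the chart `φ`. -/
def chartMetric (φ : OpenPartialHomeomorph M (EuclideanSpace ℝ (Fin n)))
    (x : EuclideanSpace ℝ (Fin n)) : Matrix (Fin n) (Fin n) ℝ :=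
  Matrix.of fun i j => inner ℝ (coordVec φ i x) (coordVec φ j x)

/-- `φ` is a smooth chart of `M` whose coordinates are orthogonal. -/
structure IsOrthogonalChart (φ : OpenPartialHomeomorph M (EuclideanSpace ℝ (Fin n))) : Prop where
  smooth : φ ∈ IsManifold.maximalAtlas (𝓡 n) ∞ M
  orthogonal : ∀ x ∈ φ.target, ∀ i j : Fin n, i ≠ j →
    inner ℝ (coordVec φ i x) (coordVec φ j x) = 0

/-- `aᵢ = √⟨∂/∂xᵢ, ∂/∂xᵢ⟩`. -/
def scaleFactor (φ : OpenPartialHomeomorph M (EuclideanSpace ℝ (Fin n))) (i : Fin n)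
    (x : EuclideanSpace ℝ (Fin n)) : ℝ :=
  √(inner ℝ (coordVec φ i x) (coordVec φ i x))

/-- The associated frame `eᵢ = (1 / aᵢ) ∂/∂xᵢ`. -/
def frameVec (φ : OpenPartialHomeomorph M (EuclideanSpace ℝ (Fin n))) (i : Fin n)
    (x : EuclideanSpace ℝ (Fin n)) : TangentSpace (𝓡 n) (φ.symm x) :=
  (scaleFactor φ i x)⁻¹ • coordVec φ i x

/-- The vector `eᵢ` of the associated frame, read in the chart `φ`. -/
def frameCoord (φ : OpenPartialHomeomorph M (EuclideanSpace ℝ (Fin n))) (i : Fin n)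
    (x : EuclideanSpace ℝ (Fin n)) : EuclideanSpace ℝ (Fin n) :=
  (scaleFactor φ i x)⁻¹ • basisVec i

/-- `R_{ijkl} = ⟨R_{eᵢeⱼ} eₖ, eₗ⟩` in the frame associated to `φ`. -/
def frameCurv (φ : OpenPartialHomeomorph M (EuclideanSpace ℝ (Fin n)))
    (x : EuclideanSpace ℝ (Fin n)) (i j k l : Fin n) : ℝ :=
  riemann (chartMetric φ) x
    (frameCoord φ i x) (frameCoord φ j x) (frameCoord φ k x) (frameCoord φ l x)

/-- The components `a_{ij} = ⟨J eᵢ, eⱼ⟩` of `J` in the frame associated to `φ`, so that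
`J eᵢ = ∑ⱼ a_{ij} eⱼ`. -/
def frameComplex (J : ∀ p : M, TangentSpace (𝓡 n) p →L[ℝ] TangentSpace (𝓡 n) p)
    (φ : OpenPartialHomeomorph M (EuclideanSpace ℝ (Fin n)))
    (x : EuclideanSpace ℝ (Fin n)) (i j : Fin n) : ℝ :=
  inner ℝ (J (φ.symm x) (frameVec φ i x)) (frameVec φ j x)

/-- The Riemannian manifold `M` with the complex-structure tensor `J` is Kähler: `J` is a smooth
orthogonal endomorphism field with `J² = -1` and `∇J = 0`, that is, `∇_X (J Y) = J (∇_X Y)` for all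
vector fields (tested in every smooth chart). -/
structure IsKahler (J : ∀ p : M, TangentSpace (𝓡 n) p →L[ℝ] TangentSpace (𝓡 n) p) : Prop where
  smooth : ContMDiff (𝓡 n)
    ((𝓡 n).prod 𝓘(ℝ, EuclideanSpace ℝ (Fin n) →L[ℝ] EuclideanSpace ℝ (Fin n))) ∞
    (fun p => Bundle.TotalSpace.mk' (EuclideanSpace ℝ (Fin n) →L[ℝ] EuclideanSpace ℝ (Fin n))
      (E := fun p : M => TangentSpace (𝓡 n) p →L[ℝ] TangentSpace (𝓡 n) p) p (J p))
  sq_eq_neg : ∀ (p : M) (v : TangentSpace (𝓡 n) p), J p (J p v) = -v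
  isometry : ∀ (p : M) (v w : TangentSpace (𝓡 n) p), inner ℝ (J p v) (J p w) = inner ℝ v w
  parallel : ∀ φ ∈ IsManifold.maximalAtlas (𝓡 n) ∞ M,
    ∀ X Y : EuclideanSpace ℝ (Fin n) → EuclideanSpace ℝ (Fin n),
    ContDiffOn ℝ ∞ X φ.target → ContDiffOn ℝ ∞ Y φ.target → ∀ x ∈ φ.target,
      covDeriv (chartMetric φ) X (fun y => chartEndo J φ y (Y y)) x
        = chartEndo J φ x (covDeriv (chartMetric φ) X Y x)

end Manifold

end OrthCoord

end

/-! Two facts about curvature meet in dimension four. In orthogonal coordinates a Christoffel symbol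
with three distinct indices vanishes, hence so does `R i j k l` for four distinct indices
(`riemann_basisVec_of_distinct`). On a Kähler manifold `∇J = 0` makes every curvature operator
commute with `J` (`curvForm_chartEndo`).

A skew orthogonal `J` on a 4-space is self-dual or anti-self-dual, according to its Pfaffian `p =
±1`. Under the splitting of 2-forms into these two types, a skew operator commutes with `J` exactly
when its component of the type of `J` is a multiple of `J`. Applied to both pairs of indices, with
pair symmetry, this says that the 3×3 block of the curvature on forms of that type is `λ a₀ⱼ a₀ₖ`.
The diagonal entries of the block are `R 0 j 0 j + R k l k l`, because the mixed terms `R 0 j k l`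
vanish. Its trace is half the scalar curvature, and equals `λ` since `∑ a₀ⱼ² = 1`. So each sum is
`a₀ⱼ² r / 2`, which is `kahler_curvature_identity`; every claim follows from this.

The rest derives the symmetries of the curvature tensor from Christoffel symbols and carries the
data of the manifold to the chart. -/

noncomputable section

namespace OrthCoord

/-! ### Curvature of a diagonal metric -/

section DiagonalMetric

set_option synthInstance.maxHeartbeats 200000

variable {n : ℕ}

/-- A smooth field of positive diagonal matrices on an open set of `ℝⁿ`. -/
structure IsDiagonalMetricOn (g : EuclideanSpace ℝ (Fin n) → Matrix (Fin n) (Fin n) ℝ)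
    (U : Set (EuclideanSpace ℝ (Fin n))) : Prop where
  isOpen : IsOpen U
  contDiffOn : ∀ i j, ContDiffOn ℝ ∞ (fun y => g y i j) U
  off_diag : ∀ y ∈ U, ∀ i j, i ≠ j → g y i j = 0
  pos : ∀ y ∈ U, ∀ i, 0 < g y i i

/-- The Christoffel symbols at `y`, as a bilinear map. -/
def christoffelForm (g : EuclideanSpace ℝ (Fin n) → Matrix (Fin n) (Fin n) ℝ)
    (y : EuclideanSpace ℝ (Fin n)) :
    EuclideanSpace ℝ (Fin n) →L[ℝ] EuclideanSpace ℝ (Fin n) →L[ℝ] EuclideanSpace ℝ (Fin n) :=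
  ∑ k, ∑ i, ∑ j, christoffel g k i j y •
    (EuclideanSpace.proj i : EuclideanSpace ℝ (Fin n) →L[ℝ] ℝ).smulRight
      ((EuclideanSpace.proj j : EuclideanSpace ℝ (Fin n) →L[ℝ] ℝ).smulRight (basisVec k))

/-- The metric at `y`, as a bilinear form. -/
def metricForm (g : EuclideanSpace ℝ (Fin n) → Matrix (Fin n) (Fin n) ℝ)
    (y : EuclideanSpace ℝ (Fin n)) :
    EuclideanSpace ℝ (Fin n) →L[ℝ] EuclideanSpace ℝ (Fin n) →L[ℝ] ℝ :=
  ∑ i, ∑ j, g y i j •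
    (EuclideanSpace.proj i : EuclideanSpace ℝ (Fin n) →L[ℝ] ℝ).smulRight
      (EuclideanSpace.proj j : EuclideanSpace ℝ (Fin n) →L[ℝ] ℝ)

variable {g : EuclideanSpace ℝ (Fin n) → Matrix (Fin n) (Fin n) ℝ}
  {U : Set (EuclideanSpace ℝ (Fin n))}

lemma basisVec_apply (i k : Fin n) : basisVec i k = if k = i then (1 : ℝ) else 0 := by
  simp [basisVec]

lemma metricForm_apply (y u v : EuclideanSpace ℝ (Fin n)) :
    metricForm g y u v = metricInner g y u v := by
  simp [metricForm, metricInner, mul_assoc]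

lemma christoffelForm_apply (y u v : EuclideanSpace ℝ (Fin n)) (k : Fin n) :
    christoffelForm g y u v k = ∑ i, ∑ j, christoffel g k i j y * u i * v j := by
  simp [christoffelForm, mul_assoc, basisVec_apply,
    Finset.sum_ite_irrel]

lemma christoffelForm_basisVec (y : EuclideanSpace ℝ (Fin n)) (i j k : Fin n) :
    christoffelForm g y (basisVec i) (basisVec j) k = christoffel g k i j y := by
  simp [christoffelForm_apply, basisVec_apply]

lemma covDeriv_eq (X Y : EuclideanSpace ℝ (Fin n) → EuclideanSpace ℝ (Fin n))
    (x : EuclideanSpace ℝ (Fin n)) :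
    covDeriv g X Y x = fderiv ℝ Y x (X x) + christoffelForm g x (X x) (Y x) := by
  ext k
  simp [covDeriv, christoffelForm_apply]

lemma covDeriv_congr {X Y Y' : EuclideanSpace ℝ (Fin n) → EuclideanSpace ℝ (Fin n)}
    {x : EuclideanSpace ℝ (Fin n)} (h : Y =ᶠ[nhds x] Y') :
    covDeriv g X Y x = covDeriv g X Y' x := by
  rw [covDeriv_eq, covDeriv_eq, h.fderiv_eq, h.eq_of_nhds]

lemma eq_sum_basisVec (v : EuclideanSpace ℝ (Fin n)) : v = ∑ i, v i • basisVec i := by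
  ext k
  simp [basisVec_apply]

lemma eq_of_eq_basisVec {f h : EuclideanSpace ℝ (Fin n) → ℝ} (hf : IsLinearMap ℝ f)
    (hh : IsLinearMap ℝ h) (H : ∀ i, f (basisVec i) = h (basisVec i))
    (v : EuclideanSpace ℝ (Fin n)) : f v = h v := by
  change hf.mk' f v = hh.mk' h v
  rw [eq_sum_basisVec v]
  simp [H]

lemma contDiffOn_smul_const {F : Type*} [NormedAddCommGroup F] [NormedSpace ℝ F]
    {f : EuclideanSpace ℝ (Fin n) → ℝ} (hf : ContDiffOn ℝ ∞ f U) (c : F) :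
    ContDiffOn ℝ ∞ (fun y => f y • c) U :=
  hf.smul contDiffOn_const

/-! ### The Levi-Civita connection of a diagonal metric. -/

namespace IsDiagonalMetricOn

lemma inv_apply (hg : IsDiagonalMetricOn g U) {y : EuclideanSpace ℝ (Fin n)} (hy : y ∈ U)
    (k l : Fin n) : (g y)⁻¹ k l = if k = l then (g y k k)⁻¹ else 0 := by
  have h : g y = Matrix.diagonal fun i => g y i i := by
    ext i j
    by_cases hij : i = j
    · subst hij; simp
    · simp [hij, hg.off_diag y hy i j hij]
  have h' : (g y)⁻¹ = Matrix.diagonal fun i => (g y i i)⁻¹ := by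
    apply Matrix.inv_eq_right_inv
    nth_rewrite 1 [h]
    rw [Matrix.diagonal_mul_diagonal, ← Matrix.diagonal_one]
    congr 1
    funext i
    exact mul_inv_cancel₀ (hg.pos y hy i).ne'
  rw [h', Matrix.diagonal_apply]

lemma symm (hg : IsDiagonalMetricOn g U) {y : EuclideanSpace ℝ (Fin n)} (hy : y ∈ U)
    (i j : Fin n) : g y i j = g y j i := by
  by_cases hij : i = j
  · rw [hij]
  · rw [hg.off_diag y hy i j hij, hg.off_diag y hy j i (Ne.symm hij)]

lemma eventually_mem (hg : IsDiagonalMetricOn g U) {y : EuclideanSpace ℝ (Fin n)} (hy : y ∈ U) :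
    ∀ᶠ z in nhds y, z ∈ U := hg.isOpen.mem_nhds hy

lemma partialDeriv_off_diag (hg : IsDiagonalMetricOn g U) {y : EuclideanSpace ℝ (Fin n)}
    (hy : y ∈ U) (m : Fin n) {i j : Fin n} (hij : i ≠ j) :
    partialDeriv m (fun z => g z i j) y = 0 := by
  have h : (fun z => g z i j) =ᶠ[nhds y] fun _ => 0 := by
    filter_upwards [hg.eventually_mem hy] with z hz using hg.off_diag z hz i j hij
  simp [partialDeriv, h.fderiv_eq]

lemma partialDeriv_symm (hg : IsDiagonalMetricOn g U) {y : EuclideanSpace ℝ (Fin n)}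
    (hy : y ∈ U) (m i j : Fin n) :
    partialDeriv m (fun z => g z i j) y = partialDeriv m (fun z => g z j i) y := by
  by_cases hij : i = j
  · rw [hij]
  · rw [hg.partialDeriv_off_diag hy m hij, hg.partialDeriv_off_diag hy m (Ne.symm hij)]

lemma christoffel_eq (hg : IsDiagonalMetricOn g U) {y : EuclideanSpace ℝ (Fin n)} (hy : y ∈ U)
    (k i j : Fin n) : christoffel g k i j y = (1 / 2 : ℝ) * ((g y k k)⁻¹ *
      (partialDeriv i (fun y => g y j k) y + partialDeriv j (fun y => g y i k) y
        - partialDeriv k (fun y => g y i j) y)) := by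
  simp [christoffel, hg.inv_apply hy]

lemma christoffel_symm (hg : IsDiagonalMetricOn g U) {y : EuclideanSpace ℝ (Fin n)} (hy : y ∈ U)
    (k i j : Fin n) : christoffel g k i j y = christoffel g k j i y := by
  rw [hg.christoffel_eq hy, hg.christoffel_eq hy, hg.partialDeriv_symm hy k i j]
  ring

lemma christoffel_of_distinct (hg : IsDiagonalMetricOn g U) {y : EuclideanSpace ℝ (Fin n)}
    (hy : y ∈ U) {k i j : Fin n} (hki : k ≠ i) (hkj : k ≠ j) (hij : i ≠ j) :
    christoffel g k i j y = 0 := by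
  rw [hg.christoffel_eq hy, hg.partialDeriv_off_diag hy _ hkj.symm,
    hg.partialDeriv_off_diag hy _ hki.symm, hg.partialDeriv_off_diag hy _ hij]
  simp

lemma christoffelForm_symm (hg : IsDiagonalMetricOn g U) {y : EuclideanSpace ℝ (Fin n)}
    (hy : y ∈ U) (u v : EuclideanSpace ℝ (Fin n)) :
    christoffelForm g y u v = christoffelForm g y v u := by
  ext k
  rw [christoffelForm_apply, christoffelForm_apply, Finset.sum_comm]
  refine Finset.sum_congr rfl fun i _ => Finset.sum_congr rfl fun j _ => ?_
  rw [hg.christoffel_symm hy]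
  ring

lemma contDiffOn_christoffel (hg : IsDiagonalMetricOn g U) (k i j : Fin n) :
    ContDiffOn ℝ ∞ (christoffel g k i j) U := by
  have hd : ∀ m i j, ContDiffOn ℝ ∞ (partialDeriv m (fun y => g y i j)) U := fun m i j =>
    ((hg.contDiffOn i j).fderiv_of_isOpen hg.isOpen (by simp)).clm_apply contDiffOn_const
  refine ContDiffOn.congr ?_ fun y hy => hg.christoffel_eq hy k i j
  exact contDiffOn_const.mul (((hg.contDiffOn k k).inv fun y hy => (hg.pos y hy k).ne').mul
    (((hd i j k).add (hd j i k)).sub (hd k i j)))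

lemma contDiffOn_christoffelForm (hg : IsDiagonalMetricOn g U) :
    ContDiffOn ℝ ∞ (christoffelForm g) U := by
  unfold christoffelForm
  exact ContDiffOn.sum fun k _ => ContDiffOn.sum fun i _ => ContDiffOn.sum fun j _ =>
    contDiffOn_smul_const (hg.contDiffOn_christoffel k i j) _

lemma contDiffOn_metricForm (hg : IsDiagonalMetricOn g U) :
    ContDiffOn ℝ ∞ (metricForm g) U := by
  unfold metricForm
  exact ContDiffOn.sum fun i _ => ContDiffOn.sum fun j _ =>
    contDiffOn_smul_const (hg.contDiffOn i j) _

lemma differentiableAt_christoffelForm (hg : IsDiagonalMetricOn g U)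
    {y : EuclideanSpace ℝ (Fin n)} (hy : y ∈ U) : DifferentiableAt ℝ (christoffelForm g) y :=
  (hg.contDiffOn_christoffelForm.contDiffAt (hg.isOpen.mem_nhds hy)).differentiableAt (by simp)

lemma differentiableAt_metricForm (hg : IsDiagonalMetricOn g U)
    {y : EuclideanSpace ℝ (Fin n)} (hy : y ∈ U) : DifferentiableAt ℝ (metricForm g) y :=
  (hg.contDiffOn_metricForm.contDiffAt (hg.isOpen.mem_nhds hy)).differentiableAt (by simp)

lemma metricForm_basisVec_right (hg : IsDiagonalMetricOn g U) {y : EuclideanSpace ℝ (Fin n)}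
    (hy : y ∈ U) (u : EuclideanSpace ℝ (Fin n)) (j : Fin n) :
    metricForm g y u (basisVec j) = g y j j * u j := by
  rw [metricForm_apply, metricInner, Finset.sum_eq_single j]
  · simp [basisVec_apply]
  · intro i _ hi
    simp [basisVec_apply, hg.off_diag y hy i j hi]
  · simp

lemma metricForm_symm (hg : IsDiagonalMetricOn g U) {y : EuclideanSpace ℝ (Fin n)}
    (hy : y ∈ U) (u v : EuclideanSpace ℝ (Fin n)) :
    metricForm g y u v = metricForm g y v u := by
  rw [metricForm_apply, metricForm_apply, metricInner, metricInner, Finset.sum_comm]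
  refine Finset.sum_congr rfl fun i _ => Finset.sum_congr rfl fun j _ => ?_
  rw [hg.symm hy]
  ring

/-- The Levi-Civita connection is compatible with the metric. -/
lemma fderiv_metricForm (hg : IsDiagonalMetricOn g U) {y : EuclideanSpace ℝ (Fin n)}
    (hy : y ∈ U) (u v w : EuclideanSpace ℝ (Fin n)) :
    fderiv ℝ (metricForm g) y u v w =
      metricForm g y (christoffelForm g y u v) w + metricForm g y v (christoffelForm g y u w) := by
  -- On coordinate vectors this is `∂ₘ gᵢⱼ = gⱼⱼ Γʲₘᵢ + gᵢᵢ Γⁱₘⱼ`. The general case follows by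
  -- linearity, one slot at a time.
  have hb : ∀ m i j : Fin n, fderiv ℝ (metricForm g) y (basisVec m) (basisVec i) (basisVec j) =
      metricForm g y (christoffelForm g y (basisVec m) (basisVec i)) (basisVec j) +
        metricForm g y (basisVec i) (christoffelForm g y (basisVec m) (basisVec j)) := by
    intro m i j
    have h1 : fderiv ℝ (metricForm g) y (basisVec m) (basisVec i) (basisVec j) =
        partialDeriv m (fun z => g z i j) y := by
      have h2 : (fun z => g z i j) = fun z => metricForm g z (basisVec i) (basisVec j) := by
        funext z
        simp [metricForm_apply, metricInner, basisVec_apply]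
      have h3 := ((hg.differentiableAt_metricForm hy).hasFDerivAt.clm_apply
        (hasFDerivAt_const (basisVec i) y)).clm_apply (hasFDerivAt_const (basisVec j) y)
      rw [partialDeriv, h2, h3.fderiv]
      simp
    rw [h1, hg.metricForm_symm hy (basisVec i), hg.metricForm_basisVec_right hy,
      hg.metricForm_basisVec_right hy, christoffelForm_basisVec, christoffelForm_basisVec,
      hg.christoffel_eq hy, hg.christoffel_eq hy, hg.partialDeriv_symm hy m j i,
      hg.partialDeriv_symm hy j m i, hg.partialDeriv_symm hy i m j]
    have hi := (hg.pos y hy i).ne'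
    have hj := (hg.pos y hy j).ne'
    field_simp
    ring
  have h1 : ∀ m i w, fderiv ℝ (metricForm g) y (basisVec m) (basisVec i) w =
      metricForm g y (christoffelForm g y (basisVec m) (basisVec i)) w +
        metricForm g y (basisVec i) (christoffelForm g y (basisVec m) w) := fun m i =>
    eq_of_eq_basisVec ⟨fun a b => by simp, fun c a => by simp⟩
      ⟨fun a b => by simp; ring, fun c a => by simp; ring⟩ (hb m i)
  have h2 : ∀ m v, fderiv ℝ (metricForm g) y (basisVec m) v w =
      metricForm g y (christoffelForm g y (basisVec m) v) w +
        metricForm g y v (christoffelForm g y (basisVec m) w) := fun m =>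
    eq_of_eq_basisVec ⟨fun a b => by simp, fun c a => by simp⟩
      ⟨fun a b => by simp; ring, fun c a => by simp; ring⟩ (fun i => h1 m i w)
  have h3 : ∀ u, fderiv ℝ (metricForm g) y u v w =
      metricForm g y (christoffelForm g y u v) w +
        metricForm g y v (christoffelForm g y u w) :=
    eq_of_eq_basisVec ⟨fun a b => by simp, fun c a => by simp⟩
      ⟨fun a b => by simp; ring, fun c a => by simp; ring⟩ (fun m => h2 m v)
  exact h3 u

end IsDiagonalMetricOn

/-- The curvature operator at `x`, in terms of the Christoffel symbols. -/
def curvForm (g : EuclideanSpace ℝ (Fin n) → Matrix (Fin n) (Fin n) ℝ)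
    (x u v w : EuclideanSpace ℝ (Fin n)) : EuclideanSpace ℝ (Fin n) :=
  fderiv ℝ (christoffelForm g) x v u w - fderiv ℝ (christoffelForm g) x u v w
    + christoffelForm g x v (christoffelForm g x u w)
    - christoffelForm g x u (christoffelForm g x v w)

/-- Constant fields commute, so the bracket term drops out. -/
lemma curvOp_const_eq (u v : EuclideanSpace ℝ (Fin n))
    (Z : EuclideanSpace ℝ (Fin n) → EuclideanSpace ℝ (Fin n)) (x : EuclideanSpace ℝ (Fin n)) :
    curvOp g (fun _ => u) (fun _ => v) Z x =
      covDeriv g (fun _ => v) (covDeriv g (fun _ => u) Z) x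
        - covDeriv g (fun _ => u) (covDeriv g (fun _ => v) Z) x := by
  simp only [curvOp, covDeriv_eq, VectorField.lieBracket]
  simp
  abel

/-! ### Tensoriality and symmetries of the curvature. -/

namespace IsDiagonalMetricOn

lemma covDeriv_covDeriv_const (hg : IsDiagonalMetricOn g U) {x : EuclideanSpace ℝ (Fin n)}
    (hx : x ∈ U) (u v : EuclideanSpace ℝ (Fin n))
    {Z : EuclideanSpace ℝ (Fin n) → EuclideanSpace ℝ (Fin n)} (hZ : ContDiffOn ℝ ∞ Z U) :
    covDeriv g (fun _ => u) (covDeriv g (fun _ => v) Z) x =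
      fderiv ℝ (fderiv ℝ Z) x u v + fderiv ℝ (christoffelForm g) x u v (Z x)
        + christoffelForm g x v (fderiv ℝ Z x u) + christoffelForm g x u (fderiv ℝ Z x v)
        + christoffelForm g x u (christoffelForm g x v (Z x)) := by
  have hZx : ContDiffAt ℝ ∞ Z x := hZ.contDiffAt (hg.isOpen.mem_nhds hx)
  have h1 : HasFDerivAt Z (fderiv ℝ Z x) x := (hZx.differentiableAt (by simp)).hasFDerivAt
  have h2 : HasFDerivAt (fderiv ℝ Z) (fderiv ℝ (fderiv ℝ Z) x) x :=
    ((hZx.fderiv_right (m := ∞) (by simp)).differentiableAt (by simp)).hasFDerivAt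
  have h3 := (hg.differentiableAt_christoffelForm hx).hasFDerivAt
  have h4 := (h2.clm_apply (hasFDerivAt_const v x)).add
    ((h3.clm_apply (hasFDerivAt_const v x)).clm_apply h1)
  have h5 : covDeriv g (fun _ => v) Z =
      fun y => fderiv ℝ Z y v + christoffelForm g y v (Z y) := by
    funext y
    rw [covDeriv_eq]
  rw [covDeriv_eq, h5]
  erw [h4.fderiv]
  simp
  abel

/-- The derivatives of `Z` enter the second covariant derivative symmetrically in `u` and `v`, so
only `Z x` survives. A non-constant `Z` is needed because `J` applied to a constant field is not
constant in the chart. -/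
lemma curvOp_const (hg : IsDiagonalMetricOn g U) {x : EuclideanSpace ℝ (Fin n)}
    (hx : x ∈ U) (u v : EuclideanSpace ℝ (Fin n))
    {Z : EuclideanSpace ℝ (Fin n) → EuclideanSpace ℝ (Fin n)} (hZ : ContDiffOn ℝ ∞ Z U) :
    curvOp g (fun _ => u) (fun _ => v) Z x = curvForm g x u v (Z x) := by
  have hZx : ContDiffAt ℝ ∞ Z x := hZ.contDiffAt (hg.isOpen.mem_nhds hx)
  have hs : fderiv ℝ (fderiv ℝ Z) x u v = fderiv ℝ (fderiv ℝ Z) x v u :=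
    (hZx.isSymmSndFDerivAt (by simpa using ENat.LEInfty.out)).eq u v
  rw [curvOp_const_eq, hg.covDeriv_covDeriv_const hx v u hZ,
    hg.covDeriv_covDeriv_const hx u v hZ, hs, curvForm]
  abel

lemma riemann_eq (hg : IsDiagonalMetricOn g U) {x : EuclideanSpace ℝ (Fin n)}
    (hx : x ∈ U) (u v w z : EuclideanSpace ℝ (Fin n)) :
    riemann g x u v w z = metricForm g x (curvForm g x u v w) z := by
  rw [riemann, hg.curvOp_const hx u v contDiffOn_const, metricForm_apply]

lemma riemann_antisymm_left (hg : IsDiagonalMetricOn g U) {x : EuclideanSpace ℝ (Fin n)}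
    (hx : x ∈ U) (u v w z : EuclideanSpace ℝ (Fin n)) :
    riemann g x v u w z = -riemann g x u v w z := by
  rw [hg.riemann_eq hx, hg.riemann_eq hx]
  have : curvForm g x v u w = -curvForm g x u v w := by
    unfold curvForm
    abel
  rw [this]
  simp

lemma fderiv_christoffelForm_symm (hg : IsDiagonalMetricOn g U) {x : EuclideanSpace ℝ (Fin n)}
    (hx : x ∈ U) (u v w : EuclideanSpace ℝ (Fin n)) :
    fderiv ℝ (christoffelForm g) x u v w = fderiv ℝ (christoffelForm g) x u w v := by
  have h3 := (hg.differentiableAt_christoffelForm hx).hasFDerivAt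
  have h4 := (h3.clm_apply (hasFDerivAt_const v x)).clm_apply (hasFDerivAt_const w x)
  have h5 := (h3.clm_apply (hasFDerivAt_const w x)).clm_apply (hasFDerivAt_const v x)
  have h6 : (fun y => christoffelForm g y v w) =ᶠ[nhds x] fun y => christoffelForm g y w v := by
    filter_upwards [hg.eventually_mem hx] with y hy using hg.christoffelForm_symm hy v w
  have h7 := congrArg (fun L => L u) (h4.unique (h5.congr_of_eventuallyEq h6))
  simpa using h7

/-- The first Bianchi identity. -/
lemma riemann_bianchi (hg : IsDiagonalMetricOn g U) {x : EuclideanSpace ℝ (Fin n)}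
    (hx : x ∈ U) (u v w z : EuclideanSpace ℝ (Fin n)) :
    riemann g x u v w z + riemann g x v w u z + riemann g x w u v z = 0 := by
  rw [hg.riemann_eq hx, hg.riemann_eq hx, hg.riemann_eq hx]
  have : curvForm g x u v w + curvForm g x v w u + curvForm g x w u v = 0 := by
    unfold curvForm
    -- By absence of torsion, `Γ` and its derivative are symmetric in the two lower slots; the six
    -- derivative terms and the six quadratic terms then cancel in pairs.
    rw [hg.fderiv_christoffelForm_symm hx v u w, hg.fderiv_christoffelForm_symm hx u v w,
      hg.fderiv_christoffelForm_symm hx w v u, hg.christoffelForm_symm hx u w,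
      hg.christoffelForm_symm hx v w, hg.christoffelForm_symm hx v u]
    abel
  rw [← add_apply, ← map_add, ← add_apply, ← map_add, this]
  simp

lemma contDiffOn_metricForm_apply (hg : IsDiagonalMetricOn g U) (w z : EuclideanSpace ℝ (Fin n)) :
    ContDiffOn ℝ ∞ (fun y => metricForm g y w z) U := by
  simp only [metricForm_apply, metricInner, mul_assoc]
  exact ContDiffOn.sum fun i _ => ContDiffOn.sum fun j _ =>
    (hg.contDiffOn i j).mul contDiffOn_const

/-- Metric compatibility differentiated once more. Exchanging `u` and `v` on the left changes
nothing, which yields skewness of the curvature in its last two slots. -/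
lemma fderiv_fderiv_metricForm (hg : IsDiagonalMetricOn g U) {x : EuclideanSpace ℝ (Fin n)}
    (hx : x ∈ U) (u v w z : EuclideanSpace ℝ (Fin n)) :
    fderiv ℝ (fderiv ℝ fun y => metricForm g y w z) x u v =
      metricForm g x (fderiv ℝ (christoffelForm g) x u v w
        + christoffelForm g x u (christoffelForm g x v w)) z
      + metricForm g x (christoffelForm g x v w) (christoffelForm g x u z)
      + metricForm g x (christoffelForm g x u w) (christoffelForm g x v z)
      + metricForm g x w (fderiv ℝ (christoffelForm g) x u v z
        + christoffelForm g x u (christoffelForm g x v z)) := by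
  have h1 : ∀ {y}, y ∈ U → HasFDerivAt (metricForm g) (fderiv ℝ (metricForm g) y) y :=
    fun hy => (hg.differentiableAt_metricForm hy).hasFDerivAt
  have hc := fun (a y : EuclideanSpace ℝ (Fin n)) => hasFDerivAt_const (𝕜 := ℝ) a y
  have h2 : HasFDerivAt (fderiv ℝ fun y => metricForm g y w z) _ x :=
    ((((hg.contDiffOn_metricForm_apply w z).contDiffAt (hg.isOpen.mem_nhds hx)).fderiv_right
      (m := ∞) (by simp)).differentiableAt (by simp)).hasFDerivAt
  have h3 := (hg.differentiableAt_christoffelForm hx).hasFDerivAt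
  have h4 := h2.clm_apply (hc v x)
  have hv := h3.clm_apply (hc v x)
  have h5 := (((h1 hx).clm_apply (hv.clm_apply (hc w x))).clm_apply (hc z x)).add
    (((h1 hx).clm_apply (hc w x)).clm_apply (hv.clm_apply (hc z x)))
  have h6 : (fun y => fderiv ℝ (fun y => metricForm g y w z) y v) =ᶠ[nhds x]
      fun y => metricForm g y (christoffelForm g y v w) z
        + metricForm g y w (christoffelForm g y v z) := by
    filter_upwards [hg.eventually_mem hx] with y hy
    rw [(((h1 hy).clm_apply (hc w y)).clm_apply (hc z y)).fderiv]
    simpa using hg.fderiv_metricForm hy v w z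
  have h7 := congrArg (fun L => L u) (h4.unique (h5.congr_of_eventuallyEq h6))
  simp [hg.fderiv_metricForm hx] at h7
  rw [h7]
  simp only [map_add, add_apply]
  ring

lemma riemann_antisymm_right (hg : IsDiagonalMetricOn g U) {x : EuclideanSpace ℝ (Fin n)}
    (hx : x ∈ U) (u v w z : EuclideanSpace ℝ (Fin n)) :
    riemann g x u v z w = -riemann g x u v w z := by
  have hs := (((hg.contDiffOn_metricForm_apply w z).contDiffAt
    (hg.isOpen.mem_nhds hx)).isSymmSndFDerivAt (by simpa using ENat.LEInfty.out)).eq u v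
  rw [hg.fderiv_fderiv_metricForm hx, hg.fderiv_fderiv_metricForm hx] at hs
  rw [hg.riemann_eq hx, hg.riemann_eq hx, hg.metricForm_symm hx _ w, curvForm, curvForm]
  simp only [map_add, map_sub, add_apply, sub_apply] at hs ⊢
  -- The mixed products of Christoffel terms are symmetric in `u` and `v` and cancel; what remains
  -- is `⟨R w, z⟩ + ⟨w, R z⟩ = 0`.
  linarith

/-- The classical octahedron argument: four instances of the Bianchi identity combined with both
skew symmetries. -/
lemma riemann_pair_symm (hg : IsDiagonalMetricOn g U) {x : EuclideanSpace ℝ (Fin n)}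
    (hx : x ∈ U) (u v w z : EuclideanSpace ℝ (Fin n)) :
    riemann g x u v w z = riemann g x w z u v := by
  have b := hg.riemann_bianchi hx
  have l := hg.riemann_antisymm_left hx
  have r := hg.riemann_antisymm_right hx
  linarith [b u v w z, b v w z u, b w z u v, b z u v w, l u v w z, r u v w z, l v w u z, r v w u z,
    l w u v z, r w u v z, l w z u v, r w z u v, l v z u w, r v z u w, l z u v w, r z u v w,
    r v w z u, l z v w u, r z v w u, l w z v u, r w z v u, l u w z v, r u w z v, l z u w v,
    r z u w v, l u v z w, l u w v z, l z u v w, l v z w u, r u v z w, r v z w u]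

/-- `Γᵏᵢⱼ` with distinct indices vanishes on the whole chart domain, so its derivatives vanish too.
In the quadratic terms, `Γᵐⱼₖ ≠ 0` forces `m = j` or `m = k`, and then `Γˡᵢₘ` has three distinct
indices. -/
lemma riemann_basisVec_of_distinct (hg : IsDiagonalMetricOn g U)
    {x : EuclideanSpace ℝ (Fin n)} (hx : x ∈ U) {i j k l : Fin n} (hij : i ≠ j) (hik : i ≠ k)
    (hil : i ≠ l) (hjk : j ≠ k) (hjl : j ≠ l) (hkl : k ≠ l) :
    riemann g x (basisVec i) (basisVec j) (basisVec k) (basisVec l) = 0 := by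
  have hΓ : ∀ {y}, y ∈ U → ∀ {i j k : Fin n}, k ≠ i → k ≠ j → i ≠ j →
      christoffelForm g y (basisVec i) (basisVec j) k = 0 := by
    intro y hy i j k h1 h2 h3
    rw [christoffelForm_basisVec, hg.christoffel_of_distinct hy h1 h2 h3]
  have hD : ∀ {i j k l : Fin n}, l ≠ j → l ≠ k → j ≠ k →
      fderiv ℝ (christoffelForm g) x (basisVec i) (basisVec j) (basisVec k) l = 0 := by
    intro i j k l h1 h2 h3
    have e1 := (hg.differentiableAt_christoffelForm hx).hasFDerivAt
    have e2 := (EuclideanSpace.proj l : EuclideanSpace ℝ (Fin n) →L[ℝ] ℝ).hasFDerivAt.comp x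
      ((e1.clm_apply (hasFDerivAt_const (basisVec j) x)).clm_apply
        (hasFDerivAt_const (basisVec k) x))
    have e3 : (fun _ => (0 : ℝ)) =ᶠ[nhds x] (EuclideanSpace.proj l ∘
        fun y => christoffelForm g y (basisVec j) (basisVec k)) := by
      filter_upwards [hg.eventually_mem hx] with y hy
      simp [hΓ hy h1 h2 h3]
    have e4 := congrArg (fun L => L (basisVec i))
      ((e2.congr_of_eventuallyEq e3).unique (hasFDerivAt_const (0 : ℝ) x))
    simpa using e4
  have hΓΓ : ∀ {i j k l : Fin n}, i ≠ j → i ≠ k → i ≠ l → j ≠ k → j ≠ l → k ≠ l →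
      christoffelForm g x (basisVec i) (christoffelForm g x (basisVec j) (basisVec k)) l = 0 := by
    intro i j k l hij hik hil hjk hjl hkl
    rw [eq_sum_basisVec (christoffelForm g x (basisVec j) (basisVec k))]
    simp only [map_sum, map_smul, WithLp.ofLp_sum, Finset.sum_apply, WithLp.ofLp_smul,
      Pi.smul_apply, smul_eq_mul]
    refine Finset.sum_eq_zero fun m _ => ?_
    by_cases hmj : m = j
    · rw [hmj, hΓ hx hil.symm hjl.symm hij, mul_zero]
    by_cases hmk : m = k
    · rw [hmk, hΓ hx hil.symm hkl.symm hik, mul_zero]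
    rw [hΓ hx hmj hmk hjk, zero_mul]
  rw [hg.riemann_eq hx, hg.metricForm_basisVec_right hx, curvForm]
  simp only [PiLp.add_apply, PiLp.sub_apply]
  rw [hD hil.symm hkl.symm hik, hD hjl.symm hkl.symm hjk,
    hΓΓ hij.symm hjk hjl hik hil hkl, hΓΓ hij hik hil hjk hjl hkl]
  simp

end IsDiagonalMetricOn

end DiagonalMetric

/-! ### The curvature identity in an orthonormal frame -/

/-- Pure linear algebra: `hcomm` says that each `R i j` commutes with `J`, and `hdist` is the trace
left by orthogonal coordinates. -/
lemma kahler_curvature_identity (R : Fin 4 → Fin 4 → Fin 4 → Fin 4 → ℝ) (a : Fin 4 → Fin 4 → ℝ)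
    (hleft : ∀ i j k l, R j i k l = -R i j k l) (hright : ∀ i j k l, R i j l k = -R i j k l)
    (hpair : ∀ i j k l, R i j k l = R k l i j)
    (hdist : ∀ i j k l, i ≠ j → i ≠ k → i ≠ l → j ≠ k → j ≠ l → k ≠ l → R i j k l = 0)
    (ha : ∀ i j, a j i = -a i j) (horth : ∀ i j, ∑ m, a i m * a j m = if i = j then 1 else 0)
    (hcomm : ∀ i j k l, ∑ m, a k m * R i j m l = -∑ m, a l m * R i j k m) :
    R 0 1 0 1 + R 2 3 2 3 = a 0 1 ^ 2 * ((∑ i, ∑ j, R i j i j) / 2) ∧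
      R 0 2 0 2 + R 1 3 1 3 = a 0 2 ^ 2 * ((∑ i, ∑ j, R i j i j) / 2) ∧
      R 0 3 0 3 + R 1 2 1 2 = a 0 3 ^ 2 * ((∑ i, ∑ j, R i j i j) / 2) := by
  have hd : ∀ i, a i i = 0 := fun i => by linarith [ha i i]
  have hl : ∀ i k l, R i i k l = 0 := fun i k l => by linarith [hleft i i k l]
  have hr : ∀ i j k, R i j k k = 0 := fun i j k => by linarith [hright i j k k]
  have o00 := horth 0 0
  have o11 := horth 1 1
  have o22 := horth 2 2
  have o33 := horth 3 3
  have o01 := horth 0 1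
  have o02 := horth 0 2
  have o03 := horth 0 3
  simp [Fin.sum_univ_four, hd, ha 0 1, ha 0 2, ha 0 3, ha 1 2, ha 1 3, ha 2 3]
    at o00 o11 o22 o33 o01 o02 o03
  -- `p` is the Pfaffian of `a`. Orthogonality of row 0 to the other rows gives the
  -- (anti-)self-duality relations `h23`, `h13`, `h12`; the row norms then give `p² = 1`.
  obtain ⟨p, hp⟩ : ∃ p, p = a 0 1 * a 2 3 - a 0 2 * a 1 3 + a 0 3 * a 1 2 := ⟨_, rfl⟩
  have h23 : a 2 3 = p * a 0 1 := by
    rw [hp]; linear_combination (-a 2 3) * o00 - a 0 2 * o03 + a 0 3 * o02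
  have h13 : a 1 3 = -(p * a 0 2) := by
    rw [hp]; linear_combination (-a 1 3) * o00 - a 0 1 * o03 + a 0 3 * o01
  have h12 : a 1 2 = p * a 0 3 := by
    rw [hp]; linear_combination (-a 1 2) * o00 + a 0 2 * o01 - a 0 1 * o02
  clear hp
  rw [h23] at o22 o33
  rw [h13] at o11 o33
  rw [h12] at o11 o22
  have hp2 : p * p = 1 := by
    linear_combination (o11 + o22 + o33) / 2 - (1 / 2 + p * p) * o00
  -- `c23`, `c13`, `c12` say that the component of `R i j` of the same duality type as `J` is
  -- parallel to `(a 0 1, a 0 2, a 0 3)`. They are commutator entries multiplied by `±p`.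
  have c23 : ∀ i j, a 0 3 * (R i j 0 2 - p * R i j 1 3) = a 0 2 * (R i j 0 3 + p * R i j 1 2) := by
    intro i j
    have h := hcomm i j 0 1
    simp [Fin.sum_univ_four, hd, hr, ha 0 1, hright i j 1 2, hright i j 1 3, h12, h13] at h
    linear_combination p * h - (a 0 3 * R i j 0 2 - a 0 2 * R i j 0 3) * hp2
  have c13 : ∀ i j, a 0 3 * (R i j 0 1 + p * R i j 2 3) = a 0 1 * (R i j 0 3 + p * R i j 1 2) := by
    intro i j
    have h := hcomm i j 0 2
    simp [Fin.sum_univ_four, hd, hr, ha 0 2, ha 1 2, hright i j 2 3, h12, h23] at h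
    linear_combination -p * h - (a 0 3 * R i j 0 1 - a 0 1 * R i j 0 3) * hp2
  have c12 : ∀ i j, a 0 2 * (R i j 0 1 + p * R i j 2 3) = a 0 1 * (R i j 0 2 - p * R i j 1 3) := by
    intro i j
    have h := hcomm i j 0 3
    simp [Fin.sum_univ_four, hd, hr, ha 0 3, ha 1 3, ha 2 3, h13, h23] at h
    linear_combination p * h - (a 0 2 * R i j 0 1 - a 0 1 * R i j 0 2) * hp2
  have d1 := hdist 0 1 2 3 (by decide) (by decide) (by decide) (by decide) (by decide) (by decide)
  have d2 := hdist 0 2 1 3 (by decide) (by decide) (by decide) (by decide) (by decide) (by decide)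
  have d3 := hdist 0 3 1 2 (by decide) (by decide) (by decide) (by decide) (by decide) (by decide)
  have d1' := (hpair 2 3 0 1).trans d1
  have d2' := (hpair 1 3 0 2).trans d2
  have d3' := (hpair 1 2 0 3).trans d3
  -- Diagonal entries of the curvature block of the type of `J`: the cross terms vanish by `hdist`,
  -- and `p² = 1`.
  have m11 : R 0 1 0 1 + p * R 0 1 2 3 + p * (R 2 3 0 1 + p * R 2 3 2 3)
      = R 0 1 0 1 + R 2 3 2 3 := by
    rw [d1, d1']; linear_combination R 2 3 2 3 * hp2
  have m22 : R 0 2 0 2 - p * R 0 2 1 3 - p * (R 1 3 0 2 - p * R 1 3 1 3)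
      = R 0 2 0 2 + R 1 3 1 3 := by
    rw [d2, d2']; linear_combination R 1 3 1 3 * hp2
  have m33 : R 0 3 0 3 + p * R 0 3 1 2 + p * (R 1 2 0 3 + p * R 1 2 1 2)
      = R 0 3 0 3 + R 1 2 1 2 := by
    rw [d3, d3']; linear_combination R 1 2 1 2 * hp2
  -- Parallelism in each pair of indices, linked through the off-diagonal entry by pair symmetry,
  -- makes the diagonal entries proportional to the squares `a 0 j ^ 2`.
  have e12 : a 0 2 ^ 2 * (R 0 1 0 1 + R 2 3 2 3) = a 0 1 ^ 2 * (R 0 2 0 2 + R 1 3 1 3) := by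
    rw [← m11, ← m22]
    linear_combination a 0 2 * (c12 0 1 + p * c12 2 3) + a 0 1 * (c12 0 2 - p * c12 1 3)
      + a 0 1 * a 0 2 * (hpair 0 1 0 2 - p * hpair 0 1 1 3 + p * hpair 2 3 0 2
        - p * p * hpair 2 3 1 3)
  have e13 : a 0 3 ^ 2 * (R 0 1 0 1 + R 2 3 2 3) = a 0 1 ^ 2 * (R 0 3 0 3 + R 1 2 1 2) := by
    rw [← m11, ← m33]
    linear_combination a 0 3 * (c13 0 1 + p * c13 2 3) + a 0 1 * (c13 0 3 + p * c13 1 2)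
      + a 0 1 * a 0 3 * (hpair 0 1 0 3 + p * hpair 0 1 1 2 + p * hpair 2 3 0 3
        + p * p * hpair 2 3 1 2)
  have e23 : a 0 3 ^ 2 * (R 0 2 0 2 + R 1 3 1 3) = a 0 2 ^ 2 * (R 0 3 0 3 + R 1 2 1 2) := by
    rw [← m22, ← m33]
    linear_combination a 0 3 * (c23 0 2 - p * c23 1 3) + a 0 2 * (c23 0 3 + p * c23 1 2)
      + a 0 2 * a 0 3 * (hpair 0 2 0 3 + p * hpair 0 2 1 2 - p * hpair 1 3 0 3
        - p * p * hpair 1 3 1 2)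
  have hs : (∑ i, ∑ j, R i j i j) / 2 = (R 0 1 0 1 + R 2 3 2 3) + (R 0 2 0 2 + R 1 3 1 3)
      + (R 0 3 0 3 + R 1 2 1 2) := by
    have hsw : ∀ i j, R j i j i = R i j i j := fun i j => by rw [hleft, hright, neg_neg]
    simp only [Fin.sum_univ_four, hl, hsw 0 1, hsw 0 2, hsw 0 3, hsw 1 2, hsw 1 3, hsw 2 3]
    ring
  rw [hs]
  -- Adding the proportionalities and using `∑ a 0 j ^ 2 = 1` (`o00`) identifies the factor with the
  -- trace.
  refine ⟨?_, ?_, ?_⟩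
  · linear_combination e12 + e13 - (R 0 1 0 1 + R 2 3 2 3) * o00
  · linear_combination -e12 + e23 - (R 0 2 0 2 + R 1 3 1 3) * o00
  · linear_combination -e13 - e23 - (R 0 3 0 3 + R 1 2 1 2) * o00

/-! ### Smoothness in a chart -/

section ChartSmooth

variable {n : ℕ} {M : Type*} [TopologicalSpace M] [ChartedSpace (EuclideanSpace ℝ (Fin n)) M]
  {φ : OpenPartialHomeomorph M (EuclideanSpace ℝ (Fin n))}

lemma mdifferentiable_of_mem_maximalAtlas
    (hφ : φ ∈ IsManifold.maximalAtlas (𝓡 n) ∞ M) : φ.MDifferentiable (𝓡 n) (𝓡 n) :=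
  ⟨(contMDiffOn_of_mem_maximalAtlas hφ).mdifferentiableOn (by simp),
    (contMDiffOn_symm_of_mem_maximalAtlas hφ).mdifferentiableOn (by simp)⟩

lemma mfderiv_symm_mfderiv (hφ : φ ∈ IsManifold.maximalAtlas (𝓡 n) ∞ M)
    {y : EuclideanSpace ℝ (Fin n)} (hy : y ∈ φ.target)
    (v : TangentSpace (𝓡 n) (φ.symm y)) :
    mfderiv (𝓡 n) (𝓡 n) φ.symm y (mfderiv (𝓡 n) (𝓡 n) φ (φ.symm y) v) = v := by
  have h := (mdifferentiable_of_mem_maximalAtlas hφ).symm_comp_deriv (φ.map_target hy)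
  rw [φ.right_inv hy] at h
  exact congrArg (fun L => L v) h

variable [IsManifold (𝓡 n) ∞ M]

lemma contMDiffOn_coord_const (hφ : φ ∈ IsManifold.maximalAtlas (𝓡 n) ∞ M)
    (v : EuclideanSpace ℝ (Fin n)) :
    ContMDiffOn (𝓡 n) ((𝓡 n).prod (𝓡 n)) ∞
      (fun y => Bundle.TotalSpace.mk' (EuclideanSpace ℝ (Fin n))
        (E := fun p : M => TangentSpace (𝓡 n) p) (φ.symm y)
        (mfderiv (𝓡 n) (𝓡 n) φ.symm y v)) φ.target := by
  have h1 := (contMDiffOn_symm_of_mem_maximalAtlas hφ).contMDiffOn_tangentMapWithin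
    (m := ∞) (by simp) φ.open_target.uniqueMDiffOn
  have h2 : ContMDiffOn (𝓡 n) (𝓡 n).tangent ∞
      (fun y => (⟨y, v⟩ : TangentBundle (𝓡 n) (EuclideanSpace ℝ (Fin n)))) φ.target :=
    contMDiffOn_vectorSpace_iff_contDiffOn.2 contDiffOn_const
  refine (h1.comp h2 fun y hy => hy).congr fun y hy => ?_
  simp only [Function.comp, tangentMapWithin, mfderivWithin_of_isOpen φ.open_target hy]

/-- The field is the tangent map of `φ` applied to `J` of a smooth section, so it may be
differentiated twice in the curvature. -/
lemma contDiffOn_chartEndo (hφ : φ ∈ IsManifold.maximalAtlas (𝓡 n) ∞ M)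
    {J : ∀ p : M, TangentSpace (𝓡 n) p →L[ℝ] TangentSpace (𝓡 n) p}
    (hJ : ContMDiff (𝓡 n)
      ((𝓡 n).prod 𝓘(ℝ, EuclideanSpace ℝ (Fin n) →L[ℝ] EuclideanSpace ℝ (Fin n))) ∞
      (fun p => Bundle.TotalSpace.mk' (EuclideanSpace ℝ (Fin n) →L[ℝ] EuclideanSpace ℝ (Fin n))
      (E := fun p : M => TangentSpace (𝓡 n) p →L[ℝ] TangentSpace (𝓡 n) p) p (J p)))
    (v : EuclideanSpace ℝ (Fin n)) :
    ContDiffOn ℝ ∞ (fun y => chartEndo J φ y v) φ.target := by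
  have h1 := (contMDiffOn_of_mem_maximalAtlas hφ).contMDiffOn_tangentMapWithin
    (m := ∞) (by simp) φ.open_source.uniqueMDiffOn
  have h2 := ContMDiffOn.clm_bundle_apply (b := φ.symm) (ϕ := fun y => J (φ.symm y))
    (hJ.comp_contMDiffOn (contMDiffOn_symm_of_mem_maximalAtlas hφ))
    (contMDiffOn_coord_const hφ v)
  have h3 := (contMDiff_snd_tangentBundle_modelSpace (EuclideanSpace ℝ (Fin n))
    (𝓡 n)).comp_contMDiffOn (h1.comp h2 fun y hy => φ.map_target hy)
  refine h3.contDiffOn.congr fun y hy => ?_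
  simp only [Function.comp, tangentMapWithin,
    mfderivWithin_of_isOpen φ.open_source (φ.map_target hy)]
  rfl

variable [Bundle.RiemannianBundle (fun p : M => TangentSpace (𝓡 n) p)]

lemma contDiffOn_chartMetric
    [IsContMDiffRiemannianBundle (𝓡 n) ∞ (EuclideanSpace ℝ (Fin n))
      (fun p : M => TangentSpace (𝓡 n) p)]
    (hφ : φ ∈ IsManifold.maximalAtlas (𝓡 n) ∞ M) (i j : Fin n) :
    ContDiffOn ℝ ∞ (fun y => chartMetric φ y i j) φ.target :=
  (ContMDiffOn.inner_bundle (contMDiffOn_coord_const hφ (basisVec i))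
    (contMDiffOn_coord_const hφ (basisVec j))).contDiffOn

end ChartSmooth

/-! ### Kähler manifolds in an orthogonal chart -/

section Kahler

variable {n : ℕ} {M : Type*} [TopologicalSpace M] [ChartedSpace (EuclideanSpace ℝ (Fin n)) M]
  {φ : OpenPartialHomeomorph M (EuclideanSpace ℝ (Fin n))}
  {J : ∀ p : M, TangentSpace (𝓡 n) p →L[ℝ] TangentSpace (𝓡 n) p}

/-- `chartEndo J φ x` as a linear map. -/
def chartEndoCLM (J : ∀ p : M, TangentSpace (𝓡 n) p →L[ℝ] TangentSpace (𝓡 n) p)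
    (φ : OpenPartialHomeomorph M (EuclideanSpace ℝ (Fin n))) (x : EuclideanSpace ℝ (Fin n)) :
    EuclideanSpace ℝ (Fin n) →L[ℝ] EuclideanSpace ℝ (Fin n) :=
  (mfderiv (𝓡 n) (𝓡 n) φ (φ.symm x)).comp
    ((J (φ.symm x)).comp (mfderiv (𝓡 n) (𝓡 n) φ.symm x))

lemma chartEndoCLM_apply (x v : EuclideanSpace ℝ (Fin n)) :
    chartEndoCLM J φ x v = chartEndo J φ x v := rfl

variable [Bundle.RiemannianBundle (fun p : M => TangentSpace (𝓡 n) p)]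

lemma metricForm_chartMetric (x u v : EuclideanSpace ℝ (Fin n)) :
    metricForm (chartMetric φ) x u v =
      inner ℝ (mfderiv (𝓡 n) (𝓡 n) φ.symm x u : TangentSpace (𝓡 n) (φ.symm x))
        (mfderiv (𝓡 n) (𝓡 n) φ.symm x v : TangentSpace (𝓡 n) (φ.symm x)) := by
  have h : ∀ w : EuclideanSpace ℝ (Fin n),
      (mfderiv (𝓡 n) (𝓡 n) φ.symm x w : TangentSpace (𝓡 n) (φ.symm x)) =
        ∑ i, w i • coordVec φ i x := by
    intro w
    conv_lhs => rw [eq_sum_basisVec w]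
    erw [map_sum]
    refine Finset.sum_congr rfl fun i _ => ?_
    erw [map_smul]
    rfl
  rw [h u, h v, metricForm_apply, metricInner]
  simp only [sum_inner, inner_sum, real_inner_smul_left, real_inner_smul_right, chartMetric,
    Matrix.of_apply]
  rw [Finset.sum_comm]
  refine Finset.sum_congr rfl fun i _ => Finset.sum_congr rfl fun j _ => ?_
  ring

/-! ### The orthonormal frame of an orthogonal chart. -/

section Frame

variable {x : EuclideanSpace ℝ (Fin n)}

lemma scaleFactor_mul_self (hg : IsDiagonalMetricOn (chartMetric φ) φ.target)
    (hx : x ∈ φ.target) (i : Fin n) :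
    scaleFactor φ i x * scaleFactor φ i x = chartMetric φ x i i :=
  Real.mul_self_sqrt (hg.pos x hx i).le

lemma scaleFactor_ne_zero (hg : IsDiagonalMetricOn (chartMetric φ) φ.target)
    (hx : x ∈ φ.target) (i : Fin n) : scaleFactor φ i x ≠ 0 :=
  (Real.sqrt_pos.2 (hg.pos x hx i)).ne'

lemma metricForm_frameCoord_right (hg : IsDiagonalMetricOn (chartMetric φ) φ.target)
    (hx : x ∈ φ.target) (v : EuclideanSpace ℝ (Fin n)) (i : Fin n) :
    metricForm (chartMetric φ) x v (frameCoord φ i x) = scaleFactor φ i x * v i := by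
  rw [frameCoord, map_smul, hg.metricForm_basisVec_right hx, ← scaleFactor_mul_self hg hx,
    smul_eq_mul]
  have := scaleFactor_ne_zero hg hx i
  field_simp

lemma eq_sum_frameCoord (hg : IsDiagonalMetricOn (chartMetric φ) φ.target)
    (hx : x ∈ φ.target) (v : EuclideanSpace ℝ (Fin n)) :
    v = ∑ i, metricForm (chartMetric φ) x v (frameCoord φ i x) • frameCoord φ i x := by
  conv_lhs => rw [eq_sum_basisVec v]
  refine Finset.sum_congr rfl fun i _ => ?_
  rw [metricForm_frameCoord_right hg hx, frameCoord, smul_smul]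
  have := scaleFactor_ne_zero hg hx i
  congr 1
  field_simp

lemma metricForm_frameCoord_frameCoord (hg : IsDiagonalMetricOn (chartMetric φ) φ.target)
    (hx : x ∈ φ.target) (i j : Fin n) :
    metricForm (chartMetric φ) x (frameCoord φ i x) (frameCoord φ j x) = if i = j then 1 else 0 := by
  rw [metricForm_frameCoord_right hg hx, frameCoord]
  have := scaleFactor_ne_zero hg hx j
  by_cases h : i = j
  · subst h; simp [basisVec_apply, this]
  · simp [basisVec_apply, h, Ne.symm h]

set_option synthInstance.maxHeartbeats 200000 in
lemma curvForm_smul (g : EuclideanSpace ℝ (Fin n) → Matrix (Fin n) (Fin n) ℝ)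
    (a b c : ℝ) (u v w : EuclideanSpace ℝ (Fin n)) :
    curvForm g x (a • u) (b • v) (c • w) = (a * b * c) • curvForm g x u v w := by
  simp only [curvForm, map_smul, smul_apply, smul_sub, smul_add, smul_smul]
  congr 1
  · congr 1
    · congr 1 <;> congr 1 <;> ring
    · congr 1; ring
  · congr 1; ring

set_option synthInstance.maxHeartbeats 200000 in
lemma curvForm_sum (g : EuclideanSpace ℝ (Fin n) → Matrix (Fin n) (Fin n) ℝ)
    (u v : EuclideanSpace ℝ (Fin n)) (c : Fin n → ℝ) (w : Fin n → EuclideanSpace ℝ (Fin n)) :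
    curvForm g x u v (∑ m, c m • w m) = ∑ m, c m • curvForm g x u v (w m) := by
  simp only [curvForm, map_sum, map_smul, smul_sub, smul_add, Finset.sum_add_distrib,
    Finset.sum_sub_distrib]

lemma frameCurv_eq (hg : IsDiagonalMetricOn (chartMetric φ) φ.target) (hx : x ∈ φ.target)
    (i j k l : Fin n) :
    frameCurv φ x i j k l =
      (scaleFactor φ i x)⁻¹ * (scaleFactor φ j x)⁻¹ * (scaleFactor φ k x)⁻¹ *
        (scaleFactor φ l x)⁻¹ *
        riemann (chartMetric φ) x (basisVec i) (basisVec j) (basisVec k) (basisVec l) := by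
  rw [frameCurv, hg.riemann_eq hx, hg.riemann_eq hx]
  simp only [frameCoord]
  rw [curvForm_smul, map_smul, map_smul, smul_apply, smul_eq_mul, smul_eq_mul]
  ring

lemma scalarCurv_eq_sum_frameCurv (hg : IsDiagonalMetricOn (chartMetric φ) φ.target)
    (hx : x ∈ φ.target) :
    scalarCurv (chartMetric φ) x = ∑ i, ∑ j, frameCurv φ x i j i j := by
  refine Finset.sum_congr rfl fun i _ => Finset.sum_congr rfl fun j _ => ?_
  simp only [hg.inv_apply hx, ite_mul, mul_ite, zero_mul, mul_zero, Finset.sum_ite_eq,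
    Finset.mem_univ, if_true]
  rw [frameCurv_eq hg hx, ← scaleFactor_mul_self hg hx, ← scaleFactor_mul_self hg hx, mul_inv,
    mul_inv]
  ring

end Frame

lemma metricForm_chartEndo_left (hφ : φ ∈ IsManifold.maximalAtlas (𝓡 n) ∞ M)
    {x : EuclideanSpace ℝ (Fin n)} (hx : x ∈ φ.target) (u v : EuclideanSpace ℝ (Fin n)) :
    metricForm (chartMetric φ) x (chartEndo J φ x u) v =
      inner ℝ (J (φ.symm x) (mfderiv (𝓡 n) (𝓡 n) φ.symm x u))
        (mfderiv (𝓡 n) (𝓡 n) φ.symm x v : TangentSpace (𝓡 n) (φ.symm x)) := by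
  rw [metricForm_chartMetric, chartEndo]
  erw [mfderiv_symm_mfderiv hφ hx]

lemma frameComplex_eq (hφ : φ ∈ IsManifold.maximalAtlas (𝓡 n) ∞ M)
    {x : EuclideanSpace ℝ (Fin n)} (hx : x ∈ φ.target) (i j : Fin n) :
    frameComplex J φ x i j =
      metricForm (chartMetric φ) x (chartEndo J φ x (frameCoord φ i x)) (frameCoord φ j x) := by
  have h : ∀ i, frameVec φ i x = mfderiv (𝓡 n) (𝓡 n) φ.symm x (frameCoord φ i x) := by
    intro i
    rw [frameVec, frameCoord]
    erw [map_smul]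
    rfl
  rw [metricForm_chartEndo_left hφ hx, frameComplex, h i, h j]

lemma chartEndo_frameCoord (hφ : φ ∈ IsManifold.maximalAtlas (𝓡 n) ∞ M)
    (hg : IsDiagonalMetricOn (chartMetric φ) φ.target)
    {x : EuclideanSpace ℝ (Fin n)} (hx : x ∈ φ.target) (i : Fin n) :
    chartEndo J φ x (frameCoord φ i x) = ∑ m, frameComplex J φ x i m • frameCoord φ m x := by
  simp only [frameComplex_eq hφ hx]
  exact eq_sum_frameCoord hg hx _

variable [IsManifold (𝓡 n) ∞ M]

lemma IsOrthogonalChart.isDiagonalMetricOn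
    [IsContMDiffRiemannianBundle (𝓡 n) ∞ (EuclideanSpace ℝ (Fin n))
      (fun p : M => TangentSpace (𝓡 n) p)]
    (hφ : IsOrthogonalChart φ) : IsDiagonalMetricOn (chartMetric φ) φ.target where
  isOpen := φ.open_target
  contDiffOn := contDiffOn_chartMetric hφ.smooth
  off_diag := hφ.orthogonal
  pos y hy i := by
    change 0 < inner ℝ (coordVec φ i y) (coordVec φ i y)
    refine real_inner_self_nonneg.lt_of_ne' fun h => ?_
    rw [inner_self_eq_zero] at h
    -- A coordinate vector of norm zero would be zero, yet the differential of `φ` sends it to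
    -- `basisVec i`.
    have h1 := (mdifferentiable_of_mem_maximalAtlas hφ.smooth).comp_symm_deriv hy
    have h2 := congrArg (fun L => L (basisVec i)) h1
    have h3 : mfderiv (𝓡 n) (𝓡 n) φ (φ.symm y) (coordVec φ i y) = basisVec i := h2
    rw [h, map_zero] at h3
    have h4 := congrArg (fun v : EuclideanSpace ℝ (Fin n) => v i) h3.symm
    simp [basisVec_apply] at h4
    exact one_ne_zero h4

/-! ### The Kähler conditions read in the chart. -/

namespace IsKahler

lemma metricForm_chartEndo_chartEndo (hJ : IsKahler J)
    (hφ : φ ∈ IsManifold.maximalAtlas (𝓡 n) ∞ M)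
    {x : EuclideanSpace ℝ (Fin n)} (hx : x ∈ φ.target) (u v : EuclideanSpace ℝ (Fin n)) :
    metricForm (chartMetric φ) x (chartEndo J φ x u) (chartEndo J φ x v) =
      metricForm (chartMetric φ) x u v := by
  rw [metricForm_chartEndo_left hφ hx, metricForm_chartMetric, ← hJ.isometry (φ.symm x)
    (mfderiv (𝓡 n) (𝓡 n) φ.symm x u), chartEndo]
  erw [mfderiv_symm_mfderiv hφ hx]

/-- `⟨u, Jv⟩ = ⟨Ju, J²v⟩ = -⟨Ju, v⟩`. -/
lemma metricForm_chartEndo_right (hJ : IsKahler J)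
    (hφ : φ ∈ IsManifold.maximalAtlas (𝓡 n) ∞ M)
    {x : EuclideanSpace ℝ (Fin n)} (hx : x ∈ φ.target) (u v : EuclideanSpace ℝ (Fin n)) :
    metricForm (chartMetric φ) x u (chartEndo J φ x v) =
      -metricForm (chartMetric φ) x (chartEndo J φ x u) v := by
  rw [metricForm_chartEndo_left hφ hx, metricForm_chartMetric, ← hJ.isometry (φ.symm x)
    (mfderiv (𝓡 n) (𝓡 n) φ.symm x u), chartEndo]
  erw [mfderiv_symm_mfderiv hφ hx]
  rw [hJ.sq_eq_neg, inner_neg_right]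

/-- The curvature of a Kähler manifold commutes with the complex structure. -/
lemma curvForm_chartEndo (hJ : IsKahler J) (hφ : φ ∈ IsManifold.maximalAtlas (𝓡 n) ∞ M)
    (hg : IsDiagonalMetricOn (chartMetric φ) φ.target)
    {x : EuclideanSpace ℝ (Fin n)} (hx : x ∈ φ.target) (u v w : EuclideanSpace ℝ (Fin n)) :
    curvForm (chartMetric φ) x u v (chartEndo J φ x w) =
      chartEndo J φ x (curvForm (chartMetric φ) x u v w) := by
  have hJw := contDiffOn_chartEndo hφ hJ.smooth w
  have hcov : ∀ u : EuclideanSpace ℝ (Fin n),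
      ContDiffOn ℝ ∞ (covDeriv (chartMetric φ) (fun _ => u) fun _ => w) φ.target := by
    intro u
    have : covDeriv (chartMetric φ) (fun _ => u) (fun _ => w) =
        fun y => christoffelForm (chartMetric φ) y u w := by
      funext y
      simp [covDeriv_eq]
    rw [this]
    exact (hg.contDiffOn_christoffelForm.clm_apply contDiffOn_const).clm_apply contDiffOn_const
  -- Parallelism is used twice. The inner use must hold at all points near `x`, because the outer
  -- derivative sees the germ of the field.
  have key : ∀ u v : EuclideanSpace ℝ (Fin n),
      covDeriv (chartMetric φ) (fun _ => u)
        (covDeriv (chartMetric φ) (fun _ => v) fun y => chartEndo J φ y w) x =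
      chartEndo J φ x (covDeriv (chartMetric φ) (fun _ => u)
        (covDeriv (chartMetric φ) (fun _ => v) fun _ => w) x) := by
    intro u v
    rw [← hJ.parallel φ hφ _ _ contDiffOn_const (hcov v) x hx]
    refine covDeriv_congr ?_
    filter_upwards [hg.eventually_mem hx] with y hy
    exact hJ.parallel φ hφ _ _ contDiffOn_const contDiffOn_const y hy
  rw [← hg.curvOp_const hx u v hJw,
    ← hg.curvOp_const hx u v (Z := fun _ => w) contDiffOn_const, curvOp_const_eq, curvOp_const_eq,
    key, key, ← chartEndoCLM_apply, ← chartEndoCLM_apply, ← chartEndoCLM_apply, map_sub]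

lemma riemann_chartEndo (hJ : IsKahler J) (hφ : φ ∈ IsManifold.maximalAtlas (𝓡 n) ∞ M)
    (hg : IsDiagonalMetricOn (chartMetric φ) φ.target)
    {x : EuclideanSpace ℝ (Fin n)} (hx : x ∈ φ.target) (u v w z : EuclideanSpace ℝ (Fin n)) :
    riemann (chartMetric φ) x u v (chartEndo J φ x w) z =
      -riemann (chartMetric φ) x u v w (chartEndo J φ x z) := by
  rw [hg.riemann_eq hx, hg.riemann_eq hx, hJ.curvForm_chartEndo hφ hg hx,
    hJ.metricForm_chartEndo_right hφ hx, neg_neg]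

end IsKahler

/-! ### Components of `J` and of the curvature in the frame. -/

section Components

variable {x : EuclideanSpace ℝ (Fin n)}

lemma frameComplex_antisymm (hJ : IsKahler J) (hφ : φ ∈ IsManifold.maximalAtlas (𝓡 n) ∞ M)
    (hg : IsDiagonalMetricOn (chartMetric φ) φ.target) (hx : x ∈ φ.target) (i j : Fin n) :
    frameComplex J φ x j i = -frameComplex J φ x i j := by
  rw [frameComplex_eq hφ hx, frameComplex_eq hφ hx, hg.metricForm_symm hx,
    hJ.metricForm_chartEndo_right hφ hx]

lemma frameComplex_orthogonal (hJ : IsKahler J) (hφ : φ ∈ IsManifold.maximalAtlas (𝓡 n) ∞ M)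
    (hg : IsDiagonalMetricOn (chartMetric φ) φ.target) (hx : x ∈ φ.target) (i j : Fin n) :
    ∑ m, frameComplex J φ x i m * frameComplex J φ x j m = if i = j then 1 else 0 := by
  rw [← metricForm_frameCoord_frameCoord hg hx, ← hJ.metricForm_chartEndo_chartEndo hφ hx,
    chartEndo_frameCoord hφ hg hx j, map_sum]
  refine Finset.sum_congr rfl fun m _ => ?_
  rw [map_smul, ← frameComplex_eq hφ hx, smul_eq_mul, mul_comm]

lemma frameCurv_frameComplex (hJ : IsKahler J) (hφ : φ ∈ IsManifold.maximalAtlas (𝓡 n) ∞ M)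
    (hg : IsDiagonalMetricOn (chartMetric φ) φ.target) (hx : x ∈ φ.target) (i j k l : Fin n) :
    ∑ m, frameComplex J φ x k m * frameCurv φ x i j m l =
      -∑ m, frameComplex J φ x l m * frameCurv φ x i j k m := by
  have h := hJ.riemann_chartEndo hφ hg hx (frameCoord φ i x) (frameCoord φ j x)
    (frameCoord φ k x) (frameCoord φ l x)
  rw [chartEndo_frameCoord hφ hg hx, chartEndo_frameCoord hφ hg hx, hg.riemann_eq hx,
    hg.riemann_eq hx, curvForm_sum] at h
  simp only [map_sum, map_smul, sum_apply, smul_apply, smul_eq_mul] at h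
  simpa only [frameCurv, hg.riemann_eq hx] using h

end Components

end Kahler

end OrthCoord

end

/-! ### The scalar curvature formula and the signs. -/

theorem mainTheorem5 {M : Type*} [TopologicalSpace M]
    [ChartedSpace (EuclideanSpace ℝ (Fin 4)) M] [IsManifold (𝓡 4) ∞ M]
    [Bundle.RiemannianBundle (fun p : M => TangentSpace (𝓡 4) p)]
    [IsContMDiffRiemannianBundle (𝓡 4) ∞ (EuclideanSpace ℝ (Fin 4))
      (fun p : M => TangentSpace (𝓡 4) p)]
    (J : ∀ p : M, TangentSpace (𝓡 4) p →L[ℝ] TangentSpace (𝓡 4) p)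
    (hJ : OrthCoord.IsKahler J)
    (φ : OpenPartialHomeomorph M (EuclideanSpace ℝ (Fin 4)))
    (hφ : OrthCoord.IsOrthogonalChart φ)
    (x : EuclideanSpace ℝ (Fin 4)) (hx : x ∈ φ.target) :
    let R := OrthCoord.frameCurv φ x
    let a := OrthCoord.frameComplex J φ x
    let r := OrthCoord.scalarCurv (OrthCoord.chartMetric φ) x
    -- the formula for the scalar curvature
    ((a 0 1 ≠ 0 → r = 2 / (a 0 1) ^ 2 * (R 0 1 0 1 + R 2 3 2 3)) ∧
      (a 0 2 ≠ 0 → r = 2 / (a 0 2) ^ 2 * (R 0 2 0 2 + R 1 3 1 3)) ∧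
      (a 0 3 ≠ 0 → r = 2 / (a 0 3) ^ 2 * (R 0 3 0 3 + R 1 2 1 2))) ∧
    -- its form when a component of the complex structure vanishes
    ((a 0 1 = 0 → R 0 1 0 1 + R 2 3 2 3 = 0) ∧
      (a 0 2 = 0 → R 0 2 0 2 + R 1 3 1 3 = 0) ∧
      (a 0 3 = 0 → R 0 3 0 3 + R 1 2 1 2 = 0)) ∧
    -- the three sums have the same sign
    ((a 0 1 ≠ 0 → SignType.sign (R 0 1 0 1 + R 2 3 2 3) = SignType.sign r) ∧
      (a 0 2 ≠ 0 → SignType.sign (R 0 2 0 2 + R 1 3 1 3) = SignType.sign r) ∧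
      (a 0 3 ≠ 0 → SignType.sign (R 0 3 0 3 + R 1 2 1 2) = SignType.sign r)) ∧
    ((0 ≤ R 0 1 0 1 + R 2 3 2 3 ∧ 0 ≤ R 0 2 0 2 + R 1 3 1 3 ∧ 0 ≤ R 0 3 0 3 + R 1 2 1 2) ∨
      (R 0 1 0 1 + R 2 3 2 3 ≤ 0 ∧ R 0 2 0 2 + R 1 3 1 3 ≤ 0 ∧ R 0 3 0 3 + R 1 2 1 2 ≤ 0)) := by
  intro R a r
  have hg := hφ.isDiagonalMetricOn
  have hR : ∀ i j k l, R i j k l = OrthCoord.riemann (OrthCoord.chartMetric φ) x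
    (OrthCoord.frameCoord φ i x) (OrthCoord.frameCoord φ j x) (OrthCoord.frameCoord φ k x)
    (OrthCoord.frameCoord φ l x) := fun _ _ _ _ => rfl
  have hr : r = ∑ i, ∑ j, R i j i j := OrthCoord.scalarCurv_eq_sum_frameCurv hg hx
  have key := OrthCoord.kahler_curvature_identity R a
    (fun i j k l => by rw [hR, hR, hg.riemann_antisymm_left hx])
    (fun i j k l => by rw [hR, hR, hg.riemann_antisymm_right hx])
    (fun i j k l => by rw [hR, hR, hg.riemann_pair_symm hx])
    (fun i j k l h1 h2 h3 h4 h5 h6 => by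
      change OrthCoord.frameCurv φ x i j k l = 0
      rw [OrthCoord.frameCurv_eq hg hx, hg.riemann_basisVec_of_distinct hx h1 h2 h3 h4 h5 h6,
        mul_zero])
    (OrthCoord.frameComplex_antisymm hJ hφ.smooth hg hx)
    (OrthCoord.frameComplex_orthogonal hJ hφ.smooth hg hx)
    (OrthCoord.frameCurv_frameComplex hJ hφ.smooth hg hx)
  rw [← hr] at key
  obtain ⟨h1, h2, h3⟩ := key
  -- Every sum is now `a 0 j ^ 2 * (r / 2)`, so each claim concerns a square times `r / 2`.
  rw [h1, h2, h3]
  have formula : ∀ b : ℝ, b ≠ 0 → r = 2 / b ^ 2 * (b ^ 2 * (r / 2)) := fun b hb => by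
    field_simp
  have vanish : ∀ b : ℝ, b = 0 → b ^ 2 * (r / 2) = 0 := fun b hb => by simp [hb]
  have sign : ∀ b : ℝ, b ≠ 0 → SignType.sign (b ^ 2 * (r / 2)) = SignType.sign r := by
    intro b hb
    rw [sign_mul, sign_pos (by positivity), one_mul, div_eq_mul_inv, sign_mul,
      sign_pos (by positivity : (0 : ℝ) < 2⁻¹), mul_one]
  refine ⟨⟨formula _, formula _, formula _⟩, ⟨vanish _, vanish _, vanish _⟩,
    ⟨sign _, sign _, sign _⟩, ?_⟩
  rcases le_total 0 r with h | h
  · left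
    refine ⟨?_, ?_, ?_⟩ <;> positivity
  · right
    refine ⟨?_, ?_, ?_⟩ <;> exact mul_nonpos_of_nonneg_of_nonpos (sq_nonneg _) (by linarith)
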